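/- Let $\mathbb{S}=(S,\eta,\mu)$ be a monad on $\mathbf{Set}$ which is \emph{consistent}, i.e. $\eta_X : X\to SX$ is injective for every set $X$. Then the following conditions are equivalent: (a) for every monad $\mathbb{T}$ on $\mathbf{Set}$ the coproduct $\mathbb{S}\oplus\mathbb{T}$ exists in the category of monads on $\mathbf{Set}$ and monad morphisms; (b) $\mathbb{S}$ is \emph{substantially exceptional}; (c) the coproduct $\mathbb{S}\oplus\mathbb{P}$ exists in that category, where $\mathbb{P}$ is the powerset monad ($X\mapsto$ the set of all subsets of $X$, with direct images, singletons as unit and unions as multiplication). Here, the \emph{exception monad} $\mathbb{M}_E$ of a set $E$ is the monad $X\mapsto X+E$, with unit the left coproduct injection and multiplication $(X+E)+E\to X+E$ the codiagonal on $E$. The \emph{Trnková closure} of a monad $\mathbb{S}$ is the monad $\widehat{\mathbb{S}}$, with a monad morphism $r:\mathbb{S}\to\widehat{\mathbb{S}}$ (unique up to unique isomorphism), such that $r_X$ is bijective for every nonempty set $X$ and the functor $\widehat{S}$ preserves finite intersections, i.e. pullbacks of pairs of monomorphisms. The monad $\mathbb{S}$ is \emph{substantially exceptional} if its Trnková closure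 is isomorphic, as a monad, to $\mathbb{M}_E$ for some set $E$. -/

import Mathlib

open CategoryTheory CategoryTheory.Limits

universe u

namespace SetMonad

/-- A monad on sets is consistent when every component of its unit is injective. -/
def IsConsistent (S : CategoryTheory.Monad (Type u)) : Prop :=
  ∀ X : Type u, Function.Injective (S.η.app X)

/-- The exception monad `M_E`, given on sets by `X ↦ X + E`. -/
def exceptionMonad (E : Type u) : CategoryTheory.Monad (Type u) where
  obj X := X ⊕ E
  map f := ↾(Sum.map f id)
  map_id X := by ext x; cases x <;> rfl
  map_comp f g := by ext x; cases x <;> rfl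
  η := { app := fun X => ↾(fun x : X => (Sum.inl x : X ⊕ E))
         naturality := by intros; rfl }
  μ := { app := fun X => ↾(Sum.elim id Sum.inr : (X ⊕ E) ⊕ E → X ⊕ E)
         naturality := by intros; ext x; rcases x with (x | x) | x <;> rfl }
  assoc X := by ext x; rcases x with ((x | x) | x) | x <;> rfl
  left_unit X := by ext x; cases x <;> rfl
  right_unit X := by ext x; cases x <;> rfl

/-- The (full, covariant) powerset monad: direct images, singletons and unions. -/
def powersetMonad : CategoryTheory.Monad (Type u) where
  obj X := Set X
  map f := ↾(fun s => f '' s)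
  map_id X := by ext s : 3; simp
  map_comp f g := by ext s : 3; simp [Set.image_image]
  η := { app := fun X => ↾(fun x : X => ({x} : Set X))
         naturality := by intros; ext s : 3; simp }
  μ := { app := fun X => ↾(fun s : Set (Set X) => ⋃₀ s)
         naturality := by intros; ext s : 3; simp [Set.image_sUnion] }
  assoc X := by
    ext s : 3
    change ⋃₀ ((fun t : Set (Set X) => ⋃₀ t) '' s) = ⋃₀ (⋃₀ s)
    ext x
    simp only [Set.sUnion_image, Set.mem_iUnion, Set.mem_sUnion]
    grind
  left_unit X := by ext s : 3; exact Set.sUnion_singleton s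
  right_unit X := by
    ext s : 3
    change ⋃₀ ((fun x : X => ({x} : Set X)) '' s) = s
    simp

/-- A set functor preserves finite intersections when it sends every pullback square of two
monomorphisms (the intersection of two subobjects) to a pullback square. -/
def PreservesFiniteIntersections (H : Type u ⥤ Type u) : Prop :=
  ∀ ⦃P A B X : Type u⦄ (p : P ⟶ A) (q : P ⟶ B) (m : A ⟶ X) (n : B ⟶ X),
    Mono m → Mono n → IsPullback p q m n →
      IsPullback (H.map p) (H.map q) (H.map m) (H.map n)

/-- `r : S ⟶ S'` exhibits `S'` as the Trnková closure of the monad `S`: the functor of `S'`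
preserves finite intersections and agrees, via the monad morphism `r`, with that of `S` on all
nonempty sets. This determines `S'` and `r` up to a unique isomorphism. -/
structure IsTrnkovaClosure {S S' : CategoryTheory.Monad (Type u)} (r : S ⟶ S') : Prop where
  preservesFiniteIntersections : PreservesFiniteIntersections S'.toFunctor
  bijective : ∀ X : Type u, Nonempty X → Function.Bijective (r.app X)

/-- A monad is substantially exceptional when its Trnková closure is isomorphic, as a monad,
to an exception monad. -/
def IsSubstantiallyExceptional (S : CategoryTheory.Monad (Type u)) : Prop :=
  ∃ (S' : CategoryTheory.Monad (Type u)) (r : S ⟶ S'), IsTrnkovaClosure r ∧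
    ∃ E : Type u, Nonempty (S' ≅ exceptionMonad E)

end SetMonad

/-! If `S` agrees with `M_E` on nonempty sets, then `S ⊕ T` is explicit: its value at `X` is `T (X ⊕
E)`, except that the value at the empty set is empty when both `S` and `T` are empty there. An
exception is interpreted in a monad `V` under `S` through the `S`-algebra `V.obj X`, which makes
sense once that set is nonempty (`hasBinaryCoproduct_of_bijective`).

Conversely, suppose that `S ⊕ P` exists and that some `t` in `S X` is neither a unit nor a constant.
For a well-ordered set `K` too large to embed in `(S ⊕ P) X`, the free `S`-algebra `A` on the
subsets of `X ⊕ K` is also given arbitrary joins. The joins are chosen so that applying `t` to joins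
of earlier elements yields a new element at each stage `k` of `K`. Both algebra structures are
morphisms into the continuation monad of `A`, hence factor through `S ⊕ P`, and the part of `A`
generated by `X` is an image of `(S ⊕ P) X`: it is too small for the `K` distinct elements
(`isPureOrConst_of_hasBinaryCoproduct`). So all elements are units or constants, and by consistency
`S` agrees on nonempty sets with the exception monad on the non-unit elements of `S 1`
(`toException_bijective`). -/

namespace SetMonad

/-! ### Kleisli calculus for monads on sets and their morphisms. -/

section Kleisli

variable (S : CategoryTheory.Monad (Type u))

/-- The unit of a monad on sets, as a function. -/
def pure {X : Type u} (x : X) : S.obj X := S.η.app X x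

/-- The Kleisli extension of a function. -/
def bind {X Y : Type u} (f : X → S.obj Y) (s : S.obj X) : S.obj Y :=
  S.μ.app Y (S.map (↾f) s)

/-- The action of a monad on functions. -/
def fmap {X Y : Type u} (f : X → Y) (s : S.obj X) : S.obj Y := S.map (↾f) s

variable {S}

theorem fmap_id {X : Type u} (s : S.obj X) : fmap S (fun x => x) s = s :=
  types_congr_hom (S.map_id X) s

theorem fmap_fmap {X Y Z : Type u} (f : X → Y) (g : Y → Z) (s : S.obj X) :
    fmap S g (fmap S f s) = fmap S (fun x => g (f x)) s :=
  (types_congr_hom (S.map_comp (↾f) (↾g)) s).symm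

theorem fmap_pure {X Y : Type u} (f : X → Y) (x : X) : fmap S f (pure S x) = pure S (f x) :=
  (types_congr_hom (S.η.naturality (↾f)) x).symm

theorem bind_pure_left {X Y : Type u} (f : X → S.obj Y) (x : X) :
    bind S f (pure S x) = f x :=
  (congrArg (S.μ.app Y) (fmap_pure f x)).trans (types_congr_hom (S.left_unit Y) (f x))

theorem bind_pure_eq_fmap {X Y : Type u} (f : X → Y) (s : S.obj X) :
    bind S (fun x => pure S (f x)) s = fmap S f s :=
  (congrArg (S.μ.app Y) (fmap_fmap f (pure S) s).symm).trans
    (types_congr_hom (S.right_unit Y) (fmap S f s))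

theorem bind_pure {X : Type u} (s : S.obj X) : bind S (pure S) s = s :=
  (bind_pure_eq_fmap (fun x => x) s).trans (fmap_id s)

theorem fmap_mu {X Y : Type u} (f : X → Y) (s : S.obj (S.obj X)) :
    fmap S f (S.μ.app X s) = S.μ.app Y (fmap S (fmap S f) s) :=
  (types_congr_hom (S.μ.naturality (↾f)) s).symm

theorem bind_bind {X Y Z : Type u} (f : X → S.obj Y) (g : Y → S.obj Z) (s : S.obj X) :
    bind S g (bind S f s) = bind S (fun x => bind S g (f x)) s := by
  change S.μ.app Z (fmap S g (S.μ.app Y (fmap S f s))) = S.μ.app Z (fmap S _ s)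
  rw [fmap_mu, fmap_fmap]
  refine (types_congr_hom (S.assoc Z) _).symm.trans (congrArg (S.μ.app Z) ?_)
  exact fmap_fmap _ (S.μ.app Z) s

theorem bind_fmap {X Y Z : Type u} (f : X → Y) (g : Y → S.obj Z) (s : S.obj X) :
    bind S g (fmap S f s) = bind S (fun x => g (f x)) s := by
  simp only [← bind_pure_eq_fmap, bind_bind, bind_pure_left]

theorem mu_eq_bind {X : Type u} (s : S.obj (S.obj X)) : S.μ.app X s = bind S (fun x => x) s :=
  congrArg (S.μ.app X) (fmap_id s).symm

end Kleisli

section Hom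

variable {S V : CategoryTheory.Monad (Type u)}

theorem hom_pure (a : S ⟶ V) {X : Type u} (x : X) : a.app X (pure S x) = pure V x :=
  types_congr_hom (a.app_η X) x

theorem hom_fmap (a : S ⟶ V) {X Y : Type u} (f : X → Y) (s : S.obj X) :
    a.app Y (fmap S f s) = fmap V f (a.app X s) :=
  types_congr_hom (a.naturality (↾f)) s

theorem hom_bind (a : S ⟶ V) {X Y : Type u} (f : X → S.obj Y) (s : S.obj X) :
    a.app Y (bind S f s) = bind V (fun x => a.app Y (f x)) (a.app X s) := by
  refine (types_congr_hom (a.app_μ Y) (fmap S f s)).trans (congrArg (V.μ.app Y) ?_)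
  refine (hom_fmap a (a.app Y) (fmap S f s)).trans ?_
  rw [hom_fmap, fmap_fmap]; rfl

theorem naturality_of_kleisli {a : ∀ X : Type u, S.obj X → V.obj X}
    (ha : ∀ (X : Type u) (x : X), a X (pure S x) = pure V x)
    (hb : ∀ (X Y : Type u) (f : X → S.obj Y) (s : S.obj X),
      a Y (bind S f s) = bind V (fun x => a Y (f x)) (a X s))
    {X Y : Type u} (f : X → Y) (s : S.obj X) : a Y (fmap S f s) = fmap V f (a X s) := by
  rw [← bind_pure_eq_fmap, hb, ← bind_pure_eq_fmap]
  simp only [ha]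

/-- A family of functions compatible with units and Kleisli extensions is a monad morphism. -/
def homOfKleisli (a : ∀ X : Type u, S.obj X → V.obj X)
    (ha : ∀ (X : Type u) (x : X), a X (pure S x) = pure V x)
    (hb : ∀ (X Y : Type u) (f : X → S.obj Y) (s : S.obj X),
      a Y (bind S f s) = bind V (fun x => a Y (f x)) (a X s)) : S ⟶ V where
  app X := ↾(a X)
  naturality X Y f := by ext s; exact naturality_of_kleisli ha hb f s
  app_η X := by ext x; exact ha X x
  app_μ X := by
    ext s
    refine (congrArg (a X) (mu_eq_bind s)).trans ((hb _ _ _ _).trans ?_)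
    exact congrArg (V.μ.app X) (naturality_of_kleisli ha hb (a X) s).symm

theorem hom_ext {a b : S ⟶ V} (h : ∀ (X : Type u) (s : S.obj X), a.app X s = b.app X s) :
    a = b :=
  MonadHom.ext' _ _ (by ext X s; exact h X s)

end Hom

/-- A monad on sets given by a Kleisli triple. -/
def ofKleisli (F : Type u → Type u) (p : ∀ X : Type u, X → F X)
    (b : ∀ {X Y : Type u}, (X → F Y) → F X → F Y)
    (left : ∀ {X Y : Type u} (f : X → F Y) (x : X), b f (p X x) = f x)
    (right : ∀ {X : Type u} (s : F X), b (p X) s = s)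
    (assoc : ∀ {X Y Z : Type u} (f : X → F Y) (g : Y → F Z) (s : F X),
      b g (b f s) = b (fun x => b g (f x)) s) : CategoryTheory.Monad (Type u) where
  obj X := F X
  map f := ↾(b (fun x => p _ (f x)))
  map_id X := by ext s; exact right s
  map_comp f g := by ext s; simp [assoc, left]
  η := { app := fun X => ↾(p X)
         naturality := by intros; ext s; simp [left] }
  μ := { app := fun X => ↾(b (fun s : F X => s))
         naturality := by intros; ext s; simp [assoc, left] }
  assoc X := by ext s; simp [assoc, left]
  left_unit X := by ext s; simp [left]
  right_unit X := by ext s; simp [assoc, left, right]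

theorem exceptionMonad_bind_inl {E X Y : Type u} (f : X → (exceptionMonad E).obj Y) (x : X) :
    bind (exceptionMonad E) f (Sum.inl x : X ⊕ E) = f x := rfl

theorem exceptionMonad_bind_inr {E X Y : Type u} (f : X → (exceptionMonad E).obj Y) (e : E) :
    bind (exceptionMonad E) f (Sum.inr e : X ⊕ E) = (Sum.inr e : Y ⊕ E) := rfl

/-! ### Coproducts with a monad that is exceptional on nonempty sets. -/

section Coproduct

variable {S T : CategoryTheory.Monad (Type u)} {E : Type u}

/-- Exceptions followed by `T`, keeping the value at the empty set only under the condition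
`ε`. -/
def exceptionComp (T : CategoryTheory.Monad (Type u)) (E : Type u) (ε : Prop) :
    CategoryTheory.Monad (Type u) :=
  ofKleisli (fun X => {_w : T.obj (X ⊕ E) // Nonempty X ∨ ε})
    (fun X x => ⟨pure T (Sum.inl x), Or.inl ⟨x⟩⟩)
    (fun {X Y} f w => ⟨bind T (Sum.elim (fun x => (f x).1) (fun e => pure T (Sum.inr e))) w.1,
      w.2.elim (fun ⟨x⟩ => (f x).2) Or.inr⟩)
    (fun f x => Subtype.ext (by simp [bind_pure_left]))
    (fun w => Subtype.ext (by
      refine Eq.trans ?_ (bind_pure w.1)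
      dsimp only
      congr 1
      ext (x | e) <;> rfl))
    (fun f g w => Subtype.ext (by
      dsimp only
      rw [bind_bind]
      congr 1
      ext (x | e)
      · rfl
      · simp [bind_pure_left]))

theorem exceptionComp_bind_val {ε : Prop} {X Y : Type u}
    (f : X → (exceptionComp T E ε).obj Y) (w : (exceptionComp T E ε).obj X) :
    (bind (exceptionComp T E ε) f w).1 =
      bind T (Sum.elim (fun x => (f x).1) (fun e => pure T (Sum.inr e))) w.1 := by
  change bind T (Sum.elim (fun t : {_w : T.obj (Y ⊕ E) // Nonempty Y ∨ ε} => t.1)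
      (fun e => pure T (Sum.inr e)))
    (bind T (Sum.elim (fun x => pure T (Sum.inl (f x))) (fun e => pure T (Sum.inr e))) w.1) = _
  rw [bind_bind]
  congr 1
  ext (x | e)
  · exact bind_pure_left _ _
  · exact bind_pure_left _ _

/-- The exceptional elements of the value at `X` of a monad over an almost exceptional one. -/
noncomputable def exceptional (r : S ⟶ exceptionMonad E)
    (hr : ∀ X : Type u, Nonempty X → Function.Bijective (r.app X))
    {V : CategoryTheory.Monad (Type u)} (a : S ⟶ V) {X : Type u} (h : Nonempty (V.obj X))
    (e : E) : V.obj X :=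
  bind V (fun v => v) (a.app _ ((Equiv.ofBijective _ (hr (V.obj X) h)).symm
    (Sum.inr e : V.obj X ⊕ E)))

variable (r : S ⟶ exceptionMonad E)
  (hr : ∀ X : Type u, Nonempty X → Function.Bijective (r.app X))

theorem app_symm {Y : Type u} (hY : Nonempty Y) (y : Y ⊕ E) :
    r.app Y ((Equiv.ofBijective _ (hr Y hY)).symm y) = y :=
  (Equiv.ofBijective _ (hr Y hY)).apply_symm_apply y

theorem fmap_symm {Y Z : Type u} (hY : Nonempty Y) (hZ : Nonempty Z) (f : Y → Z) (e : E) :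
    fmap S f ((Equiv.ofBijective _ (hr Y hY)).symm (Sum.inr e : Y ⊕ E)) =
      (Equiv.ofBijective _ (hr Z hZ)).symm (Sum.inr e : Z ⊕ E) := by
  apply (hr Z hZ).1
  rw [app_symm r hr hZ, hom_fmap, app_symm r hr hY]
  rfl

theorem bind_exceptional {V : CategoryTheory.Monad (Type u)} (a : S ⟶ V) {X Y : Type u}
    (hX : Nonempty (V.obj X)) (hY : Nonempty (V.obj Y)) (f : X → V.obj Y) (e : E) :
    bind V f (exceptional r hr a hX e) = exceptional r hr a hY e := by
  unfold exceptional
  rw [bind_bind, ← fmap_symm r hr hX hY (bind V f), hom_fmap, bind_fmap]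

theorem hom_exceptional {V W : CategoryTheory.Monad (Type u)} (a : S ⟶ W) (d : W ⟶ V)
    {X : Type u} (hW : Nonempty (W.obj X)) (hV : Nonempty (V.obj X)) (e : E) :
    d.app X (exceptional r hr a hW e) = exceptional r hr (a ≫ d) hV e := by
  unfold exceptional
  rw [hom_bind, ← fmap_symm r hr hW hV (d.app X), hom_fmap, bind_fmap]
  rfl

theorem eq_exceptional {V : CategoryTheory.Monad (Type u)} (a : S ⟶ V) {X : Type u}
    (h : Nonempty (V.obj X)) (s : S.obj X) (e : E) (hs : r.app X s = (Sum.inr e : X ⊕ E)) :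
    a.app X s = exceptional r hr a h e := by
  have : fmap S (pure V) s = (Equiv.ofBijective _ (hr _ h)).symm (Sum.inr e : V.obj X ⊕ E) := by
    apply (hr _ h).1
    rw [app_symm r hr h, hom_fmap, hs]
    rfl
  unfold exceptional
  rw [← this, hom_fmap, bind_fmap, bind_pure]

theorem eq_pure (r : S ⟶ exceptionMonad E)
    (hr : ∀ X : Type u, Nonempty X → Function.Bijective (r.app X)) {X : Type u} (s : S.obj X) (x : X) (hs : r.app X s = (Sum.inl x : X ⊕ E)) :
    s = pure S x := by
  apply (hr X ⟨x⟩).1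
  rw [hs, hom_pure]
  rfl

variable (S T) in
/-- The condition under which the coproduct of `S` and `T` is nonempty at the empty set. -/
def InhabitedAtEmpty : Prop := Nonempty (S.obj PEmpty.{u+1}) ∨ Nonempty (T.obj PEmpty.{u+1})

theorem nonempty_or_inhabitedAtEmpty_left {X : Type u} (s : S.obj X) :
    Nonempty X ∨ InhabitedAtEmpty S T := by
  rcases isEmpty_or_nonempty X with h | h
  · exact Or.inr (Or.inl ⟨fmap S (fun x => h.elim x) s⟩)
  · exact Or.inl h

theorem nonempty_or_inhabitedAtEmpty_right {X : Type u} (t : T.obj X) :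
    Nonempty X ∨ InhabitedAtEmpty S T := by
  rcases isEmpty_or_nonempty X with h | h
  · exact Or.inr (Or.inr ⟨fmap T (fun x => h.elim x) t⟩)
  · exact Or.inl h

theorem nonempty_obj {V : CategoryTheory.Monad (Type u)} (a : S ⟶ V) (b : T ⟶ V) {X : Type u}
    (h : Nonempty X ∨ InhabitedAtEmpty S T) : Nonempty (V.obj X) := by
  rcases h with ⟨⟨x⟩⟩ | ⟨⟨s⟩⟩ | ⟨⟨t⟩⟩
  · exact ⟨pure V x⟩
  · exact ⟨a.app X (fmap S PEmpty.elim s)⟩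
  · exact ⟨b.app X (fmap T PEmpty.elim t)⟩

/-- The coproduct injection of `S`. -/
def exceptionCompInl : S ⟶ exceptionComp T E (InhabitedAtEmpty S T) :=
  homOfKleisli
    (fun X s => ⟨pure T (r.app X s), nonempty_or_inhabitedAtEmpty_left s⟩)
    (fun X x => Subtype.ext (by rw [hom_pure]; rfl))
    (fun X Y f s => by
      refine Subtype.ext (Eq.trans ?_ (exceptionComp_bind_val _ _).symm)
      refine Eq.trans ?_ (bind_pure_left _ _).symm
      rw [hom_bind]
      obtain ⟨x, hx⟩ | ⟨e, he⟩ : (∃ x, r.app X s = (Sum.inl x : X ⊕ E)) ∨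
          ∃ e, r.app X s = (Sum.inr e : X ⊕ E) := by
        generalize r.app X s = z
        rcases z with x | e
        exacts [Or.inl ⟨x, rfl⟩, Or.inr ⟨e, rfl⟩]
      · rw [hx, exceptionMonad_bind_inl]; rfl
      · rw [he, exceptionMonad_bind_inr]; rfl)

/-- The coproduct injection of `T`. -/
def exceptionCompInr : T ⟶ exceptionComp T E (InhabitedAtEmpty S T) :=
  homOfKleisli
    (fun X t => ⟨bind T (fun x => pure T (Sum.inl x)) t, nonempty_or_inhabitedAtEmpty_right t⟩)
    (fun X x => Subtype.ext (by rw [bind_pure_left]; rfl))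
    (fun X Y f t => by
      refine Subtype.ext (Eq.trans ?_ (exceptionComp_bind_val _ _).symm)
      simp only [bind_bind, bind_pure_left, Sum.elim_inl])

/-- The interpretation of `X + E` in a monad under `S` and `T`. -/
noncomputable def interp {V : CategoryTheory.Monad (Type u)} (a : S ⟶ V) {X : Type u}
    (h : Nonempty (V.obj X)) : X ⊕ E → V.obj X :=
  Sum.elim (pure V) (exceptional r hr a h)

theorem interp_app {V : CategoryTheory.Monad (Type u)} (a : S ⟶ V) {X : Type u}
    (h : Nonempty (V.obj X)) (s : S.obj X) : interp r hr a h (r.app X s) = a.app X s := by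
  obtain ⟨x, hx⟩ | ⟨e, he⟩ : (∃ x, r.app X s = (Sum.inl x : X ⊕ E)) ∨
      ∃ e, r.app X s = (Sum.inr e : X ⊕ E) := by
    generalize r.app X s = z
    rcases z with x | e
    exacts [Or.inl ⟨x, rfl⟩, Or.inr ⟨e, rfl⟩]
  · rw [hx, eq_pure r hr s x hx, hom_pure]; rfl
  · rw [he, eq_exceptional r hr a h s e he]; rfl

/-- The morphism out of the coproduct. -/
noncomputable def exceptionCompDesc {V : CategoryTheory.Monad (Type u)} (a : S ⟶ V)
    (b : T ⟶ V) : exceptionComp T E (InhabitedAtEmpty S T) ⟶ V :=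
  homOfKleisli
    (fun X w => bind V (interp r hr a (nonempty_obj a b w.2)) (b.app _ w.1))
    (fun X x => by
      refine (congrArg _ (hom_pure b (Sum.inl x))).trans ?_
      rw [bind_pure_left]; rfl)
    (fun X Y f w => by
      refine (congrArg (fun t => bind V _ (b.app _ t)) (exceptionComp_bind_val f w)).trans ?_
      dsimp only
      rw [hom_bind, bind_bind, bind_bind]
      congr 1
      ext (x | e)
      · exact (bind_pure_left (S := V) (fun x => bind V (interp r hr a (nonempty_obj a b (f x).2))
          (b.app _ (f x).1)) x).symm
      · simp only [Sum.elim_inr, hom_pure, bind_pure_left]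
        exact (bind_exceptional r hr a (nonempty_obj a b w.2)
          (nonempty_obj a b (w.2.elim (fun ⟨x⟩ => (f x).2) Or.inr)) _ e).symm)

/-- Uniqueness of the morphism out of the coproduct: each element is a `T`-term whose entries are
variables and exceptions coming from `S`, so a morphism is determined by its restrictions to `S` and
`T`. -/
theorem exceptionComp_hom_app {V : CategoryTheory.Monad (Type u)}
    (d : exceptionComp T E (InhabitedAtEmpty S T) ⟶ V) {X : Type u}
    (h : Nonempty (V.obj X)) (w : (exceptionComp T E (InhabitedAtEmpty S T)).obj X) :
    d.app X w = bind V (interp r hr (exceptionCompInl r ≫ d) h)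
      ((exceptionCompInr (S := S) ≫ d).app _ w.1) := by
  have hw : bind _ (interp r hr (exceptionCompInl r) ⟨w⟩)
      ((exceptionCompInr (S := S) (T := T) (E := E)).app _ w.1) = w := by
    refine Subtype.ext ((exceptionComp_bind_val _ _).trans ?_)
    change bind T _ (bind T _ w.1) = w.1
    rw [bind_bind]
    refine Eq.trans ?_ (bind_pure w.1)
    congr 1
    ext (x | e)
    · rw [bind_pure_left]; rfl
    · rw [bind_pure_left]
      change Subtype.val (exceptional r hr (exceptionCompInl r) ⟨w⟩ e) = _
      refine (exceptionComp_bind_val _ _).trans ?_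
      change bind T _ (pure T (r.app _ _)) = _
      refine (bind_pure_left _ _).trans ?_
      rw [app_symm r hr ⟨w⟩]
      rfl
  conv_lhs => rw [← hw]
  rw [hom_bind]
  refine congrArg (fun k => bind V k _) ?_
  ext (x | e)
  · exact hom_pure d x
  · exact hom_exceptional r hr _ d ⟨w⟩ h e

theorem inl_exceptionCompDesc {V : CategoryTheory.Monad (Type u)} (a : S ⟶ V) (b : T ⟶ V) :
    exceptionCompInl r ≫ exceptionCompDesc r hr a b = a :=
  hom_ext fun X s => by
    change bind V _ (b.app _ (pure T (r.app X s))) = _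
    rw [hom_pure]
    exact (bind_pure_left _ _).trans (interp_app r hr a _ s)

theorem inr_exceptionCompDesc {V : CategoryTheory.Monad (Type u)} (a : S ⟶ V) (b : T ⟶ V) :
    exceptionCompInr ≫ exceptionCompDesc r hr a b = b :=
  hom_ext fun X t => by
    change bind V _ (b.app _ (bind T _ t)) = _
    simp only [hom_bind, bind_bind, hom_pure, bind_pure_left]
    exact bind_pure _

theorem hasBinaryCoproduct_of_bijective (r : S ⟶ exceptionMonad E)
    (hr : ∀ X : Type u, Nonempty X → Function.Bijective (r.app X))
    (T : CategoryTheory.Monad (Type u)) : HasBinaryCoproduct S T :=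
  HasColimit.mk ⟨_, BinaryCofan.IsColimit.mk
    (BinaryCofan.mk (exceptionCompInl r) (exceptionCompInr (S := S) (T := T) (E := E)))
    (fun a b => exceptionCompDesc r hr a b)
    (fun a b => inl_exceptionCompDesc r hr a b)
    (fun a b => inr_exceptionCompDesc r hr a b)
    (fun a b d ha hb => hom_ext fun X w => by
      subst ha hb
      exact exceptionComp_hom_app r hr d _ w)⟩

end Coproduct

theorem IsSubstantiallyExceptional.hasBinaryCoproduct {S : CategoryTheory.Monad (Type u)}
    (h : IsSubstantiallyExceptional S) (T : CategoryTheory.Monad (Type u)) :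
    HasBinaryCoproduct S T := by
  obtain ⟨S', r, hr, E, ⟨i⟩⟩ := h
  refine hasBinaryCoproduct_of_bijective (r ≫ i.hom) (fun X hX => ?_) T
  have hi : Function.Bijective (i.hom.app X) := by
    refine Function.bijective_iff_has_inverse.2 ⟨i.inv.app X, fun s => ?_, fun s => ?_⟩
    · exact congrArg (fun d : S' ⟶ S' => d.app X s) i.hom_inv_id
    · exact congrArg (fun d : exceptionMonad E ⟶ exceptionMonad E => d.app X s) i.inv_hom_id
  exact hi.comp (hr.bijective X hX)

/-! ### Recognizing exception monads by their elements. -/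

theorem preservesFiniteIntersections_exceptionMonad (E : Type u) :
    PreservesFiniteIntersections (exceptionMonad E).toFunctor := by
  intro P A B X p q m n hm hn h
  rw [Types.isPullback_iff] at h ⊢
  obtain ⟨h₁, h₂, h₃⟩ := h
  refine ⟨?_, ?_, ?_⟩
  · rw [← Functor.map_comp, h₁, Functor.map_comp]
  · rintro (x | e) (y | e') ⟨ha, hb⟩
    · exact congrArg Sum.inl (h₂ x y ⟨Sum.inl_injective ha, Sum.inl_injective hb⟩)
    · exact absurd ha Sum.inl_ne_inr
    · exact absurd ha Sum.inr_ne_inl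
    · exact congrArg Sum.inr (Sum.inr_injective ha)
  · rintro (x | e) (y | e') hxy
    · obtain ⟨z, hz, hz'⟩ := h₃ x y (Sum.inl_injective hxy)
      exact ⟨Sum.inl z, congrArg Sum.inl hz, congrArg Sum.inl hz'⟩
    · exact absurd hxy Sum.inl_ne_inr
    · exact absurd hxy Sum.inr_ne_inl
    · exact ⟨Sum.inr e, rfl, congrArg Sum.inr (Sum.inr_injective hxy)⟩

/-- Every element of every value of the monad is a unit or a constant. -/
def IsPureOrConst (S : CategoryTheory.Monad (Type u)) : Prop :=
  ∀ (X : Type u) (x₀ : X) (s : S.obj X), (∃ x, s = pure S x) ∨ fmap S (fun _ => x₀) s = s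

section

variable {S : CategoryTheory.Monad (Type u)}

/-- The image of an element in the value at the one-point set. -/
def shape {X : Type u} (s : S.obj X) : S.obj PUnit.{u+1} := fmap S (fun _ => PUnit.unit) s

theorem shape_pure {X : Type u} (x : X) : shape (pure S x) = pure S PUnit.unit :=
  fmap_pure _ x

theorem shape_fmap {X Y : Type u} (f : X → Y) (s : S.obj X) : shape (fmap S f s) = shape s :=
  fmap_fmap _ _ s

theorem IsPureOrConst.fmap_shape (h : IsPureOrConst S) {X : Type u} (x : X) {s : S.obj X}
    (hs : shape s ≠ pure S PUnit.unit) : fmap S (fun _ => x) (shape s) = s := by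
  obtain ⟨y, rfl⟩ | h := h X x s
  · exact absurd (shape_pure y) hs
  · exact (fmap_fmap _ _ s).trans h

theorem IsPureOrConst.eq_pure_of_shape (hS : IsConsistent S) (h : IsPureOrConst S) {X : Type u}
    {s : S.obj X} (hs : shape s = pure S PUnit.unit) : ∃ x, s = pure S x := by
  rcases isEmpty_or_nonempty X with hX | ⟨⟨x⟩⟩
  -- Over the empty set there is only one map to the two-point set, so such an `s` would identify
  -- two units there, against consistency.
  · have key (b : ULift.{u} Bool) : fmap S (fun x : X => hX.elim x) s = pure S b := by
      rw [← fmap_pure (fun _ : PUnit => b) PUnit.unit, ← hs, shape, fmap_fmap]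
      congr 1
      ext x
      exact hX.elim x
    exact absurd (hS _ ((key ⟨true⟩).symm.trans (key ⟨false⟩))) (by simp)
  · obtain h | h := h X x s
    · exact h
    · refine ⟨x, ?_⟩
      rw [← h, ← fmap_pure (fun _ : PUnit => x) PUnit.unit, ← hs, shape, fmap_fmap]

variable (S) in
/-- The exceptions of a monad: the nontrivial elements of its value at the one-point set. -/
abbrev Exceptions : Type u := {c : S.obj PUnit.{u+1} // c ≠ pure S PUnit.unit}

open Classical in
/-- The comparison with the exception monad on the exceptions of `S`. -/
noncomputable def toExceptionFun (hS : IsConsistent S) (h : IsPureOrConst S) (X : Type u)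
    (s : S.obj X) : X ⊕ Exceptions S :=
  if hs : shape s = pure S PUnit.unit then Sum.inl (h.eq_pure_of_shape hS hs).choose
  else Sum.inr ⟨shape s, hs⟩

theorem toExceptionFun_pure (hS : IsConsistent S) (h : IsPureOrConst S) {X : Type u} (x : X) :
    toExceptionFun hS h X (pure S x) = Sum.inl x := by
  rw [toExceptionFun, dif_pos (shape_pure x)]
  exact congrArg Sum.inl (hS X (h.eq_pure_of_shape hS (shape_pure x)).choose_spec).symm

theorem toExceptionFun_of_ne (hS : IsConsistent S) (h : IsPureOrConst S) {X : Type u}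
    {s : S.obj X} (hs : shape s ≠ pure S PUnit.unit) :
    toExceptionFun hS h X s = Sum.inr ⟨shape s, hs⟩ :=
  dif_neg hs

/-- A non-unit shape forces a constant, and a constant ignores what is substituted into it; one may
thus substitute the unit. -/
theorem IsPureOrConst.shape_bind (h : IsPureOrConst S) {X Y : Type u} (f : X → S.obj Y)
    {s : S.obj X} (hs : shape s ≠ pure S PUnit.unit) : shape (bind S f s) = shape s := by
  have key : fmap S (fun _ => pure S PUnit.unit) (shape s) = fmap S (fun x => shape (f x)) s := by
    rw [← shape_fmap (fun x => shape (f x)) s] at hs ⊢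
    exact h.fmap_shape (pure S PUnit.unit) hs
  calc shape (bind S f s) = bind S (fun c => c) (fmap S (fun x => shape (f x)) s) := by
        rw [shape, ← bind_pure_eq_fmap, bind_bind, bind_fmap]
        simp only [bind_pure_eq_fmap]
        rfl
    _ = shape s := by
        rw [← key, bind_fmap]
        exact bind_pure (shape s)

/-- The comparison with the exception monad as a monad morphism. -/
noncomputable def toException (hS : IsConsistent S) (h : IsPureOrConst S) :
    S ⟶ exceptionMonad (Exceptions S) :=
  homOfKleisli (toExceptionFun hS h) (fun _ x => toExceptionFun_pure hS h x) (fun X Y f s => by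
    by_cases hs : shape s = pure S PUnit.unit
    · obtain ⟨x, rfl⟩ := h.eq_pure_of_shape hS hs
      rw [bind_pure_left, toExceptionFun_pure]
      rfl
    · have hb := h.shape_bind f hs
      rw [toExceptionFun_of_ne hS h hs, toExceptionFun_of_ne hS h (hb.trans_ne hs)]
      exact congrArg Sum.inr (Subtype.ext hb))

theorem toException_bijective (hS : IsConsistent S) (h : IsPureOrConst S) (X : Type u)
    (hX : Nonempty X) : Function.Bijective ((toException hS h).app X) := by
  obtain ⟨x⟩ := hX
  refine Function.bijective_iff_has_inverse.2
    ⟨(Sum.elim (pure S) fun c => fmap S (fun _ => x) c.1 : X ⊕ Exceptions S → S.obj X), ?_, ?_⟩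
  · intro s
    change Sum.elim _ _ (toExceptionFun hS h X s) = s
    by_cases hs : shape s = pure S PUnit.unit
    · obtain ⟨y, rfl⟩ := h.eq_pure_of_shape hS hs
      rw [toExceptionFun_pure]
      rfl
    · rw [toExceptionFun_of_ne hS h hs]
      exact h.fmap_shape x hs
  · rintro (y | c)
    · exact toExceptionFun_pure hS h y
    · have hc : shape (fmap S (fun _ => x) c.1) = c.1 := (shape_fmap _ _).trans (fmap_id c.1)
      exact (toExceptionFun_of_ne hS h (hc.trans_ne c.2)).trans
        (congrArg Sum.inr (Subtype.ext hc))

theorem IsPureOrConst.isSubstantiallyExceptional (hS : IsConsistent S) (h : IsPureOrConst S) :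
    IsSubstantiallyExceptional S :=
  ⟨_, toException hS h, ⟨preservesFiniteIntersections_exceptionMonad _,
    toException_bijective hS h⟩, _, ⟨Iso.refl _⟩⟩

end

/-! ### Algebras with arbitrary joins, and the cardinality argument. -/

/-- Adjoining to a complete lattice elements comparable only with the bottom and the top. -/
theorem exists_sup_extending {L A : Type*} [CompleteLattice L] [Nontrivial L] {φ : L → A}
    (hφ : Function.Injective φ) :
    ∃ sup : Set A → A, (∀ x, sup {x} = x) ∧ (∀ 𝒮 : Set (Set A), sup (⋃₀ 𝒮) = sup (sup '' 𝒮)) ∧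
      ∀ Z : Set L, sup (φ '' Z) = φ (sSup Z) := by
  let le (a b : A) : Prop := a = b ∨ (∃ x y, x ≤ y ∧ a = φ x ∧ b = φ y) ∨ a = φ ⊥ ∨ b = φ ⊤
  have le_iff (x y : L) : le (φ x) (φ y) ↔ x ≤ y := by
    constructor
    · rintro (h | ⟨x', y', hxy, hx, hy⟩ | h | h)
      · exact (hφ h).le
      · rwa [hφ hx, hφ hy]
      · exact (hφ h).trans_le bot_le
      · exact le_top.trans_eq (hφ h).symm
    · exact fun h => Or.inr (Or.inl ⟨x, y, h, rfl, rfl⟩)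
  have le_iff_left {a : A} (ha : a ∉ Set.range φ) (b : A) : le a b ↔ a = b ∨ b = φ ⊤ := by
    constructor
    · rintro (h | ⟨x, y, -, rfl, -⟩ | rfl | h)
      · exact Or.inl h
      · exact absurd ⟨x, rfl⟩ ha
      · exact absurd ⟨_, rfl⟩ ha
      · exact Or.inr h
    · exact fun h => h.elim Or.inl fun h => Or.inr (Or.inr (Or.inr h))
  have le_iff_right {b : A} (hb : b ∉ Set.range φ) (a : A) : le a b ↔ a = b ∨ a = φ ⊥ := by
    constructor
    · rintro (h | ⟨x, y, -, -, rfl⟩ | h | rfl)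
      · exact Or.inl h
      · exact absurd ⟨y, rfl⟩ hb
      · exact Or.inr h
      · exact absurd ⟨_, rfl⟩ hb
    · exact fun h => h.elim Or.inl fun h => Or.inr (Or.inr (Or.inl h))
  have bot_ne_top : φ ⊥ ≠ φ ⊤ := fun h => bot_ne_top (hφ h)
  let inst : PartialOrder A :=
    { le := le
      le_refl := fun a => Or.inl rfl
      le_trans := fun a b c hab hbc => by
        by_cases ha : a ∈ Set.range φ
        · obtain ⟨x, rfl⟩ := ha
          by_cases hc : c ∈ Set.range φ
          · obtain ⟨z, rfl⟩ := hc
            by_cases hb : b ∈ Set.range φ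
            · obtain ⟨y, rfl⟩ := hb
              rw [le_iff] at *
              exact hab.trans hbc
            · rw [le_iff_right hb] at hab
              rw [le_iff_left hb] at hbc
              grind
          · rw [le_iff_right hc] at *
            obtain rfl | rfl := hbc
            · exact (le_iff_right hc _).1 hab
            · rw [le_iff, le_bot_iff] at hab
              exact Or.inr (congrArg φ hab)
        · rw [le_iff_left ha] at *
          obtain rfl | rfl := hab
          · exact (le_iff_left ha _).1 hbc
          · by_cases hc : c ∈ Set.range φ
            · obtain ⟨z, rfl⟩ := hc
              rw [le_iff, top_le_iff] at hbc
              exact Or.inr (congrArg φ hbc)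
            · rw [le_iff_right hc] at hbc
              grind
      le_antisymm := fun a b hab hba => by
        by_cases ha : a ∈ Set.range φ
        · obtain ⟨x, rfl⟩ := ha
          by_cases hb : b ∈ Set.range φ
          · obtain ⟨y, rfl⟩ := hb
            rw [le_iff] at *
            rw [hab.antisymm hba]
          · rw [le_iff_right hb] at hab
            rw [le_iff_left hb] at hba
            grind
        · rw [le_iff_left ha] at hab
          rw [le_iff_right ha] at hba
          grind }
  have isLUB_image (Z : Set L) : IsLUB (φ '' Z) (φ (sSup Z)) := by
    constructor
    · rintro _ ⟨x, hx, rfl⟩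
      exact (le_iff _ _).2 (le_sSup hx)
    · intro u hu
      by_cases h : u ∈ Set.range φ
      · obtain ⟨y, rfl⟩ := h
        exact (le_iff _ _).2 (sSup_le fun x hx => (le_iff _ _).1 (hu ⟨x, hx, rfl⟩))
      · refine (le_iff_right h _).2 (Or.inr (congrArg φ (sSup_eq_bot.2 fun x hx => ?_)))
        obtain rfl | h' := (le_iff_right h _).1 (hu ⟨x, hx, rfl⟩)
        · exact absurd ⟨x, rfl⟩ h
        · exact hφ h'
  have exists_isLUB (Z : Set A) : ∃ s, IsLUB Z s := by
    by_cases h : Z ⊆ Set.range φ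
    · obtain ⟨Z, rfl⟩ := Set.subset_range_iff_exists_image_eq.1 h
      exact ⟨_, isLUB_image Z⟩
    · obtain ⟨r, hr, hr'⟩ := Set.not_subset.1 h
      by_cases hu : r ∈ upperBounds Z
      · exact ⟨r, hu, fun u hu => hu hr⟩
      -- Only `r` and `φ ⊤` lie above the adjoined element `r`, so once `r` fails to bound `Z` the
      -- top is the sole upper bound.
      · refine ⟨φ ⊤, fun a _ => Or.inr (Or.inr (Or.inr rfl)), fun u hu' => ?_⟩
        obtain rfl | rfl := (le_iff_left hr' u).1 (hu' hr)
        · exact absurd hu' hu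
        · exact le_rfl
  choose sup hsup using exists_isLUB
  refine ⟨sup, fun x => (hsup {x}).unique isLUB_singleton, fun 𝒮 => (hsup _).unique ?_,
    fun Z => (hsup _).unique (isLUB_image Z)⟩
  constructor
  · rintro a ⟨s, hs, ha⟩
    exact ((hsup s).1 ha).trans ((hsup (sup '' 𝒮)).1 ⟨s, hs, rfl⟩)
  · intro u hu
    refine (hsup (sup '' 𝒮)).2 ?_
    rintro _ ⟨s, hs, rfl⟩
    exact (hsup s).2 fun a ha => hu ⟨s, hs, ha⟩

/-- The continuation monad with answers in `A`. -/
def continuationMonad (A : Type u) : CategoryTheory.Monad (Type u) :=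
  ofKleisli (fun X => (X → A) → A) (fun _ x f => f x) (fun f s g => s (fun x => f x g))
    (fun _ _ => rfl) (fun _ => rfl) (fun _ _ _ => rfl)

section

variable {S U : CategoryTheory.Monad (Type u)} {A : Type u}

/-- The monad morphism to the continuation monad given by an algebra structure. -/
def algebraHom (α : S.obj A → A) (hp : ∀ a, α (pure S a) = a)
    (hb : ∀ s : S.obj (S.obj A), α (bind S (fun x => x) s) = α (fmap S α s)) :
    S ⟶ continuationMonad A :=
  homOfKleisli (fun X s f => α (fmap S f s))
    (fun X x => funext fun f => by rw [fmap_pure, hp]; rfl)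
    (fun X Y f s => funext fun g => by
      have : fmap S g (bind S f s) = bind S (fun x => x) (fmap S (fun x => fmap S g (f x)) s) := by
        rw [← bind_pure_eq_fmap, bind_bind, bind_fmap]
        simp only [bind_pure_eq_fmap]
      rw [this, hb, fmap_fmap]
      rfl)

/-- The part of `A` generated by a family, for a monad morphism to the continuation monad. -/
def generated (d : U ⟶ continuationMonad A) {X : Type u} (f : X → A) : Set A :=
  Set.range fun v : U.obj X => (show (X → A) → A from d.app X v) f

theorem mem_generated (d : U ⟶ continuationMonad A) {X : Type u} (f : X → A) (x : X) :
    f x ∈ generated d f :=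
  ⟨pure U x, congrFun (hom_pure d x) f⟩

/-- The generated part is closed under the `S`-operations, since an operation on values of `U`-terms
is the value of the `U`-term obtained by Kleisli substitution. -/
theorem algebra_mem_generated {α : S.obj A → A} (hp : ∀ a, α (pure S a) = a)
    (hb : ∀ s : S.obj (S.obj A), α (bind S (fun x => x) s) = α (fmap S α s))
    (i : S ⟶ U) (d : U ⟶ continuationMonad A) (hd : i ≫ d = algebraHom α hp hb)
    {X : Type u} (f : X → A) {W : Type u} (g : W → A) (hg : ∀ w, g w ∈ generated d f)
    (s : S.obj W) : α (fmap S g s) ∈ generated d f := by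
  choose v hv using hg
  refine ⟨bind U v (i.app W s), ?_⟩
  refine (congrFun (hom_bind d v (i.app W s)) f).trans ?_
  have hs : d.app W (i.app W s) = (algebraHom α hp hb).app W s :=
    congrArg (fun h : S ⟶ continuationMonad A => h.app W s) hd
  rw [hs]
  change α (fmap S (fun w => (show (X → A) → A from d.app X (v w)) f) s) = _
  exact congrArg (fun g => α (fmap S g s)) (funext hv)

end

section

variable {X K : Type u} [LinearOrder K]

/-- The tag `x` together with all labels below `k`. -/
def initialSet (k : K) (x : X) : Set (X ⊕ K) := insert (Sum.inl x) (Sum.inr '' Set.Iio k)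

theorem inr_mem_initialSet {j k : K} {x : X} : Sum.inr j ∈ initialSet k x ↔ j < k := by
  simp [initialSet]

theorem inl_mem_initialSet {k : K} {x y : X} : Sum.inl y ∈ initialSet k x ↔ y = x := by
  simp [initialSet]

theorem initialSet_injective (k : K) : Function.Injective (initialSet (X := X) k) := fun x y h =>
  inl_mem_initialSet.1 (h ▸ inl_mem_initialSet.2 rfl : Sum.inl x ∈ initialSet k y)

theorem eq_of_initialSet_eq {j k : K} {x y : X} (h : initialSet j x = initialSet k y) : j = k := by
  refine eq_of_forall_lt_iff fun i => ?_
  rw [← inr_mem_initialSet (x := x), h, inr_mem_initialSet]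

theorem initialSet_ne_singleton (j k : K) (x : X) : initialSet k x ≠ {Sum.inr j} := fun h => by
  have : Sum.inl x ∈ ({Sum.inr j} : Set (X ⊕ K)) := h ▸ inl_mem_initialSet.2 rfl
  simp at this

theorem sSup_singletons_initialSet (k : K) (x : X) :
    sSup (insert {Sum.inl x} ((fun j => {Sum.inr j}) '' Set.Iio k) : Set (Set (X ⊕ K))) =
      initialSet k x := by
  ext z
  simp [initialSet, eq_comm]

end

theorem isPureOrConst_of_hasBinaryCoproduct {S : CategoryTheory.Monad (Type u)}
    (hS : IsConsistent S) [HasBinaryCoproduct S powersetMonad.{u}] : IsPureOrConst S := by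
  classical
  by_contra hcon
  unfold IsPureOrConst at hcon
  push Not at hcon
  obtain ⟨X, x₀, t, ht, ht'⟩ := hcon
  let U := S ⨿ powersetMonad.{u}
  obtain ⟨K, hK⟩ : ∃ K : Type u, ∀ v : K → U.obj X, ¬ Function.Injective v :=
    ⟨Set (U.obj X), Function.cantor_injective⟩
  obtain ⟨_, _⟩ := exists_wellFoundedLT K
  -- Copies of `t` on disjoint supports. The retraction `r k` recovers `t` from `T k` but collapses
  -- every other `T j` to a constant at `x₀`; this gives injectivity, as `t` is not constant.
  let T (k : K) : S.obj (Set (X ⊕ K)) := fmap S (initialSet k) t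
  let r (k : K) : Set (X ⊕ K) → X := Function.extend (initialSet k) (fun x => x) fun _ => x₀
  have hr (k : K) (x : X) : r k (initialSet k x) = x := (initialSet_injective k).extend_apply _ _ x
  have hr' {j k : K} (hjk : j ≠ k) (x : X) : r k (initialSet j x) = x₀ :=
    Function.extend_apply' _ _ _ fun ⟨y, hy⟩ => hjk (eq_of_initialSet_eq hy).symm
  have hT (k : K) : fmap S (r k) (T k) = t := by
    simp only [T, fmap_fmap, hr, fmap_id]
  have T_inj : Function.Injective T := fun j k h => by
    by_contra hjk
    refine ht' ?_
    rw [← hT k, ← h]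
    simp only [T, fmap_fmap, hr' hjk]
  have T_ne (k : K) (Z : Set (X ⊕ K)) : T k ≠ pure S Z := fun h => by
    refine ht (r k Z) ?_
    rw [← hT k, h, fmap_pure]
  -- The power set lattice is embedded by units, except that the atom of the label `k` is sent to `T
  -- k`: this feeds the results of `S`-operations back into the joins.
  let φ (Z : Set (X ⊕ K)) : S.obj (Set (X ⊕ K)) :=
    if h : ∃ k, Z = {Sum.inr k} then T h.choose else pure S Z
  have φ_inr (k : K) : φ {Sum.inr k} = T k := by
    have h : ∃ j, ({Sum.inr k} : Set (X ⊕ K)) = {Sum.inr j} := ⟨k, rfl⟩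
    have hk : h.choose = k := by simp
    simp only [φ, dif_pos h, hk]
  have φ_of_ne {Z : Set (X ⊕ K)} (h : ∀ k, Z ≠ {Sum.inr k}) : φ Z = pure S Z :=
    dif_neg fun ⟨k, hk⟩ => h k hk
  have φ_inj : Function.Injective φ := fun Z Z' h => by
    by_cases hZ : ∃ k, Z = {Sum.inr k}
    · obtain ⟨k, rfl⟩ := hZ
      by_cases hZ' : ∃ k, Z' = {Sum.inr k}
      · obtain ⟨k', rfl⟩ := hZ'
        rw [φ_inr, φ_inr] at h
        rw [T_inj h]
      · rw [φ_inr, φ_of_ne (not_exists.1 hZ')] at h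
        exact absurd h (T_ne _ _)
    · rw [φ_of_ne (not_exists.1 hZ)] at h
      by_cases hZ' : ∃ k, Z' = {Sum.inr k}
      · obtain ⟨k', rfl⟩ := hZ'
        rw [φ_inr] at h
        exact absurd h.symm (T_ne _ _)
      · rw [φ_of_ne (not_exists.1 hZ')] at h
        exact hS _ h
  -- Makes the power set lattice nontrivial, as the extension of joins requires.
  have : Nonempty X := ⟨x₀⟩
  obtain ⟨sup, sup_singleton, sup_sUnion, sup_image⟩ := exists_sup_extending φ_inj
  let a : S ⟶ continuationMonad (S.obj (Set (X ⊕ K))) :=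
    algebraHom (bind S fun s => s) (fun s => bind_pure_left _ s)
      (fun s => by rw [bind_bind, bind_fmap])
  have sup_bind (s : powersetMonad.obj (powersetMonad.obj (S.obj (Set (X ⊕ K))))) :
      sup (bind powersetMonad (fun Z => Z) s) = sup (fmap powersetMonad sup s) := by
    rw [← mu_eq_bind]
    exact sup_sUnion s
  let b : powersetMonad.{u} ⟶ continuationMonad (S.obj (Set (X ⊕ K))) :=
    algebraHom (S := powersetMonad.{u}) sup sup_singleton sup_bind
  let d : U ⟶ continuationMonad (S.obj (Set (X ⊕ K))) := coprod.desc a b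
  let f (x : X) : S.obj (Set (X ⊕ K)) := φ {Sum.inl x}
  have sup_mem {Z : Set (S.obj (Set (X ⊕ K)))} (hZ : Z ⊆ generated d f) :
      sup Z ∈ generated d f := by
    have := algebra_mem_generated (S := powersetMonad.{u}) (α := sup) sup_singleton sup_bind
      coprod.inr d (coprod.inr_desc a b) f (fun z : Z => z.1) (fun z => hZ z.2) (Set.univ : Set Z)
    have hZ' : fmap powersetMonad.{u} (fun z : Z => z.1) (Set.univ : Set Z) = Z := by
      change (fun z : Z => z.1) '' Set.univ = Z
      simp
    rwa [hZ'] at this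
  have T_mem (k : K) : T k ∈ generated d f := by
    induction k using WellFoundedLT.induction with
    | ind k ih =>
    -- The unit at an initial set is the join of the generator at `x` and the earlier `T j`;
    -- applying `t` to these units then gives `T k`.
    have hk (x : X) : pure S (initialSet k x) ∈ generated d f := by
      rw [← φ_of_ne (fun j => initialSet_ne_singleton j k x), ← sSup_singletons_initialSet,
        ← sup_image]
      refine sup_mem ?_
      rintro _ ⟨_, rfl | ⟨j, hj, rfl⟩, rfl⟩
      · exact mem_generated d f x
      · rw [φ_inr]
        exact ih j hj
    have := algebra_mem_generated _ _ coprod.inl d (coprod.inl_desc a b) f _ hk t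
    rw [bind_fmap] at this
    rwa [bind_pure_eq_fmap] at this
  choose v hv using T_mem
  exact hK v fun j k h => T_inj (by rw [← hv j, ← hv k, h])

end SetMonad

theorem mainTheorem6 (S : CategoryTheory.Monad (Type u)) (hS : SetMonad.IsConsistent S) :
    List.TFAE [
      ∀ T : CategoryTheory.Monad (Type u), CategoryTheory.Limits.HasBinaryCoproduct S T,
      SetMonad.IsSubstantiallyExceptional S,
      CategoryTheory.Limits.HasBinaryCoproduct S SetMonad.powersetMonad.{u}] := by
  tfae_have 1 → 3 := fun h => h _
  tfae_have 3 → 2 := fun _ =>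
    (SetMonad.isPureOrConst_of_hasBinaryCoproduct hS).isSubstantiallyExceptional hS
  tfae_have 2 → 1 := fun h => h.hasBinaryCoproduct
  tfae_finish
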